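/- Definitions. An effect algebra is a system $(E;0,1,\oplus)$ with a partial binary operation $\oplus$ such that for all $a,b,c\in E$: (i) if $a\oplus b$ is defined, then $b\oplus a$ is defined and $a\oplus b=b\oplus a$; (ii) if $a\oplus b$ and $(a\oplus b)\oplus c$ are defined, then $b\oplus c$ and $a\oplus(b\oplus c)$ are defined and $(a\oplus b)\oplus c=a\oplus(b\oplus c)$; (iii) for every $a$ there is a unique $a^\perp$ with $a\oplus a^\perp=1$; (iv) if $a\oplus 1$ is defined, then $a=0$. A morphism $\phi:E\to F$ satisfies $\phi(1)=1$ and, whenever $a\oplus b$ is defined, $\phi(a)\oplus\phi(b)$ is defined and equals $\phi(a\oplus b)$. A bimorphism $\beta:E\times F\to L$ preserves defined sums in each variable separately and satisfies $\beta(1,1)=1$. The tensor product $E\otimes F$ (which always exists) is an effect algebra with a universal bimorphism $(e,f)\mapsto e\otimes f$; for morphisms $f:E\to E'$ and $g:F\to F'$, $f\otimes g:E\otimes F\to E'\otimes F'$ is the unique morphism with $(f\otimes g)(a\otimes b)=f(a)\otimes g(b)$. $E$ has the Riesz decomposition property if $a_1\oplus a_2=b_1\oplus b_2$ implies the existence of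 $c_{ij}\in E$ $(i,j\in\{1,2\})$ with $a_i=c_{i1}\oplus c_{i2}$ and $b_j=c_{1j}\oplus c_{2j}$. A simplicial effect algebra is a finite effect algebra with the Riesz decomposition property. A directed system of effect algebras over a nonempty directed set $I$ consists of effect algebras $A_i$ $(i\in I)$ and morphisms $f_{ij}:A_j\to A_i$ $(j\le i)$ with $f_{ii}=\mathrm{id}$ and $f_{ij}f_{jm}=f_{im}$ for $m\le j\le i$; direct limits are taken in the category of effect algebras. A dimension effect algebra is a direct limit of a directed system of simplicial effect algebras. Theorem. Let $A_I=(A_i;\,f_{ij}:A_j\to A_i,\ j\le i \text{ in } I)$ and $B_J=(B_k;\,g_{k\ell}:B_\ell\to B_k,\ \ell\le k\text{ in }J)$ be directed systems of simplicial effect algebras with direct limits $(\bar A;(f_i:A_i\to\bar A)_{i\in I})$ and $(\bar B;(g_k:B_k\to\bar B)_{k\in J})$. Then, with $I\times J$ ordered componentwise, $$A_I\otimes B_J:=\bigl(A_i\otimes B_k;\ f_{ij}\otimes g_{k\ell}:A_j\otimes B_\ell\to A_i\otimes B_k,\ (j,\ell)\le(i,k)\bigr)$$ is a directed system of simplicial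 effect algebras, and $(\bar A\otimes\bar B;\ (f_i\otimes g_k:A_i\otimes B_k\to\bar A\otimes\bar B)_{(i,k)\in I\times J})$ is its direct limit in the category of effect algebras. Consequently, if $E$ and $F$ are dimension effect algebras, then $E\otimes F$ is a dimension effect algebra. -/

import Mathlib

universe u v w x

/-- An effect algebra. The partial operation `⊕` is `oplus : E → E → Option E`: the sum `a ⊕ b` is
defined and equal to `c` exactly when `oplus a b = some c`. -/
class EffectAlgebra (E : Type u) extends Zero E, One E where
  oplus : E → E → Option E
  oplus_comm : ∀ {a b c : E}, oplus a b = some c → oplus b a = some c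
  oplus_assoc : ∀ {a b c d e : E}, oplus a b = some d → oplus d c = some e →
    ∃ f, oplus b c = some f ∧ oplus a f = some e
  exists_unique_orthosupplement : ∀ a : E, ∃! a' : E, oplus a a' = some 1
  eq_zero_of_oplus_one : ∀ {a c : E}, oplus a 1 = some c → a = 0

namespace EffectAlgebra

/-- A morphism of effect algebras. -/
structure Hom (E : Type u) (F : Type v) [EffectAlgebra E] [EffectAlgebra F] where
  toFun : E → F
  map_one' : toFun 1 = 1
  map_oplus' : ∀ {a b c : E}, oplus a b = some c → oplus (toFun a) (toFun b) = some (toFun c)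

instance {E : Type u} {F : Type v} [EffectAlgebra E] [EffectAlgebra F] :
    FunLike (Hom E F) E F where
  coe := Hom.toFun
  coe_injective f g h := by cases f; cases g; congr

/-- The Riesz decomposition property: if `a₁ ⊕ a₂ = b₁ ⊕ b₂`, there are `c₁₁, c₁₂, c₂₁, c₂₂` with
`aᵢ = cᵢ₁ ⊕ cᵢ₂` and `bⱼ = c₁ⱼ ⊕ c₂ⱼ`. -/
def HasRDP (E : Type u) [EffectAlgebra E] : Prop :=
  ∀ a₁ a₂ b₁ b₂ s : E, oplus a₁ a₂ = some s → oplus b₁ b₂ = some s →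
    ∃ c₁₁ c₁₂ c₂₁ c₂₂ : E,
      oplus c₁₁ c₁₂ = some a₁ ∧ oplus c₂₁ c₂₂ = some a₂ ∧
      oplus c₁₁ c₂₁ = some b₁ ∧ oplus c₁₂ c₂₂ = some b₂

/-- A simplicial effect algebra: a finite effect algebra with the Riesz decomposition property. -/
def IsSimplicial (E : Type u) [EffectAlgebra E] : Prop :=
  Finite E ∧ HasRDP E

/-- `(L; φ i : A i → L)` is the direct limit, in the category of effect algebras, of the
system `(A i; f h : A j → A i, j ≤ i)`. -/
structure IsDirectLimit {I : Type u} [Preorder I] {A : I → Type u} [∀ i, EffectAlgebra (A i)]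
    (f : ∀ ⦃j i : I⦄, j ≤ i → Hom (A j) (A i))
    {L : Type u} [EffectAlgebra L] (φ : ∀ i, Hom (A i) L) : Prop where
  compatible : ∀ (j i : I) (h : j ≤ i) (a : A j), φ i (f h a) = φ j a
  universal : ∀ (C : Type u) [EffectAlgebra C] (ψ : ∀ i, Hom (A i) C),
    (∀ (j i : I) (h : j ≤ i) (a : A j), ψ i (f h a) = ψ j a) →
      ∃! χ : Hom L C, ∀ (i : I) (a : A i), χ (φ i a) = ψ i a

/-- A dimension effect algebra: the direct limit of some directed system of simplicial effect
algebras (over a nonempty directed index set). -/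
def IsDimension (E : Type u) [EffectAlgebra E] : Prop :=
  ∃ (I : Type u) (_ : Preorder I) (_ : IsDirectedOrder I) (_ : Nonempty I)
    (A : I → Type u) (_ : ∀ i, EffectAlgebra (A i))
    (f : ∀ ⦃j i : I⦄, j ≤ i → Hom (A j) (A i)) (φ : ∀ i, Hom (A i) E),
    DirectedSystem A (fun _ _ h => f h) ∧ (∀ i, IsSimplicial (A i)) ∧ IsDirectLimit f φ

/-- Bimorphisms `E × F → L` of effect algebras. -/
structure IsBimorphism {E : Type u} {F : Type v} {L : Type w}
    [EffectAlgebra E] [EffectAlgebra F] [EffectAlgebra L] (β : E → F → L) : Prop where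
  oplus_left : ∀ {a b c : E} (q : F), oplus a b = some c → oplus (β a q) (β b q) = some (β c q)
  oplus_right : ∀ (p : E) {c d e : F}, oplus c d = some e → oplus (β p c) (β p d) = some (β p e)
  map_one_one : β 1 1 = 1

/-- `(T, τ)` is the tensor product of `E` and `F`: `τ` is a universal bimorphism. -/
def IsTensorProduct {E : Type u} {F : Type v} {T : Type w}
    [EffectAlgebra E] [EffectAlgebra F] [EffectAlgebra T] (τ : E → F → T) : Prop :=
  IsBimorphism τ ∧ ∀ (L : Type x) [EffectAlgebra L] (β : E → F → L), IsBimorphism β →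
    ∃! φ : Hom T L, ∀ e f, φ (τ e f) = β e f

/-! ### Construction of the tensor product

The tensor product is built from formal expressions in the symbols `e ⊗ f`. Since `⊕` is partial,
the relation `Rel s t` reads: both expressions are defined and they have the same value, as a
consequence of the effect algebra axioms and of the bimorphism laws. -/

/-- Formal expressions in the symbols `e ⊗ f`. -/
inductive Term (E : Type u) (F : Type v) : Type (max u v)
  | tmul : E → F → Term E F
  | one : Term E F
  | perp : Term E F → Term E F
  | add : Term E F → Term E F → Term E F

/-- `Rel s t`: the expressions `s` and `t` are defined and equal. -/
inductive Rel {E : Type u} {F : Type v} [EffectAlgebra E] [EffectAlgebra F] :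
    Term E F → Term E F → Prop
  | tmul (e : E) (f : F) : Rel (.tmul e f) (.tmul e f)
  | one : Rel .one .one
  | symm {s t} : Rel s t → Rel t s
  | trans {r s t} : Rel r s → Rel s t → Rel r t
  | perp {s t} : Rel s t → Rel (.perp s) (.perp t)
  | add {s s' t t'} : Rel s s' → Rel t t' → Rel (.add s t) (.add s t) →
      Rel (.add s t) (.add s' t')
  | left {s t} : Rel (.add s t) (.add s t) → Rel s s
  | of_perp {t} : Rel (.perp t) (.perp t) → Rel t t
  | comm {s t} : Rel (.add s t) (.add s t) → Rel (.add s t) (.add t s)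
  | assoc {r s t} : Rel (.add (.add r s) t) (.add (.add r s) t) →
      Rel (.add (.add r s) t) (.add r (.add s t))
  | add_perp {t} : Rel t t → Rel (.add t (.perp t)) .one
  | eq_perp {s t} : Rel (.add s t) .one → Rel t (.perp s)
  | add_one {t} : Rel (.add t .one) (.add t .one) → Rel t (.perp .one)
  | oplus_left {a b c : E} (q : F) : oplus a b = some c →
      Rel (.add (.tmul a q) (.tmul b q)) (.tmul c q)
  | oplus_right (p : E) {c d e : F} : oplus c d = some e →
      Rel (.add (.tmul p c) (.tmul p d)) (.tmul p e)
  | one_one : Rel (.tmul 1 1) .one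

section Construction

variable {E : Type u} {F : Type v} [EffectAlgebra E] [EffectAlgebra F]

theorem Rel.refl_left {s t : Term E F} (h : Rel s t) : Rel s s := h.trans h.symm

theorem Rel.refl_right {s t : Term E F} (h : Rel s t) : Rel t t := h.symm.trans h

theorem Rel.right {s t : Term E F} (h : Rel (.add s t) (.add s t)) : Rel t t :=
  h.comm.refl_right.left

variable (E F) in
/-- Equality of defined expressions. -/
def termSetoid : Setoid {t : Term E F // Rel t t} where
  r s t := Rel s.1 t.1
  iseqv := ⟨fun s => s.2, fun h => h.symm, fun h h' => h.trans h'⟩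

variable (E F) in
/-- The tensor product of two effect algebras: defined expressions modulo equality. -/
def Tensor : Type (max u v) := Quotient (termSetoid E F)

/-- The element of the tensor product given by a defined expression. -/
def Tensor.mk (t : Term E F) (h : Rel t t) : Tensor E F :=
  Quotient.mk (termSetoid E F) ⟨t, h⟩

theorem Tensor.mk_eq {s t : Term E F} {hs : Rel s s} {ht : Rel t t} :
    Tensor.mk s hs = Tensor.mk t ht ↔ Rel s t :=
  ⟨fun h => Quotient.exact h, fun h => Quotient.sound (s := termSetoid E F) h⟩

theorem Tensor.ind {P : Tensor E F → Prop} (h : ∀ t ht, P (Tensor.mk t ht)) (x : Tensor E F) :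
    P x :=
  Quotient.ind (fun t => h t.1 t.2) x

open Classical in
/-- The partial sum on the tensor product: `[s] ⊕ [t] = [s ⊕ t]` when `s ⊕ t` is defined. -/
noncomputable def Tensor.oplus (x y : Tensor E F) : Option (Tensor E F) :=
  Quotient.liftOn₂ x y
    (fun s t => if h : Rel (.add s.1 t.1) (.add s.1 t.1) then some (Tensor.mk _ h) else none)
    (by
      intro s t s' t' hs ht
      have hs : Rel s.1 s'.1 := hs
      have ht : Rel t.1 t'.1 := ht
      by_cases h : Rel (.add s.1 t.1) (.add s.1 t.1)
      · have h' := hs.add ht h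
        simp only [dif_pos h, dif_pos h'.refl_right, Option.some.injEq]
        exact Tensor.mk_eq.2 h'
      · have h' : ¬ Rel (.add s'.1 t'.1) (.add s'.1 t'.1) :=
          fun h' => h (hs.symm.add ht.symm h').refl_right
        simp only [dif_neg h, dif_neg h'])

open Classical in
theorem Tensor.oplus_mk {r s t : Term E F} {hr : Rel r r} {hs : Rel s s} {ht : Rel t t} :
    Tensor.oplus (Tensor.mk r hr) (Tensor.mk s hs) = some (Tensor.mk t ht) ↔
      Rel (.add r s) t := by
  change (dite _ _ _ = _) ↔ _
  by_cases h : Rel (.add r s) (.add r s)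
  · rw [dif_pos h, Option.some.injEq, Tensor.mk_eq]
  · rw [dif_neg h]
    exact ⟨fun h' => by simp at h', fun h' => absurd h'.refl_left h⟩

noncomputable instance : EffectAlgebra (Tensor E F) where
  zero := Tensor.mk (.perp .one) Rel.one.perp
  one := Tensor.mk .one .one
  oplus := Tensor.oplus
  oplus_comm {a b c} := by
    induction a using Tensor.ind with | _ a ha
    induction b using Tensor.ind with | _ b hb
    induction c using Tensor.ind with | _ c hc
    rw [Tensor.oplus_mk, Tensor.oplus_mk]
    exact fun h => h.refl_left.comm.symm.trans h
  oplus_assoc {a b c d e} := by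
    induction a using Tensor.ind with | _ a ha
    induction b using Tensor.ind with | _ b hb
    induction c using Tensor.ind with | _ c hc
    induction d using Tensor.ind with | _ d hd
    induction e using Tensor.ind with | _ e he
    rw [Tensor.oplus_mk, Tensor.oplus_mk]
    intro h₁ h₂
    have h₃ : Rel (.add d c) (.add (.add a b) c) := h₁.symm.add hc h₂.refl_left
    have h₄ := h₃.refl_right.assoc
    exact ⟨Tensor.mk (.add b c) h₄.refl_right.right, Tensor.oplus_mk.2 h₄.refl_right.right,
      Tensor.oplus_mk.2 (h₄.symm.trans (h₃.symm.trans h₂))⟩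
  exists_unique_orthosupplement a := by
    induction a using Tensor.ind with | _ a ha
    refine ⟨Tensor.mk (.perp a) ha.perp, Tensor.oplus_mk.2 ha.add_perp, fun b => ?_⟩
    induction b using Tensor.ind with | _ b hb
    exact fun h => Tensor.mk_eq.2 (Tensor.oplus_mk.1 h).eq_perp
  eq_zero_of_oplus_one {a c} := by
    induction a using Tensor.ind with | _ a ha
    induction c using Tensor.ind with | _ c hc
    exact fun h => Tensor.mk_eq.2 (Tensor.oplus_mk.1 h).refl_left.add_one

/-- The element `e ⊗ f` of the tensor product. -/
def tmul (e : E) (f : F) : Tensor E F := Tensor.mk (.tmul e f) (.tmul e f)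

theorem isBimorphism_tmul : IsBimorphism (tmul : E → F → Tensor E F) where
  oplus_left q h := Tensor.oplus_mk.2 (.oplus_left q h)
  oplus_right p _ _ _ h := Tensor.oplus_mk.2 (.oplus_right p h)
  map_one_one := Tensor.mk_eq.2 .one_one

variable {L : Type w} [EffectAlgebra L]

/-- The value, if defined, of an expression under a map `β : E × F → L`. -/
noncomputable def Term.eval (β : E → F → L) : Term E F → Option L
  | .tmul e f => some (β e f)
  | .one => some 1
  | .perp t => (t.eval β).map fun a => (exists_unique_orthosupplement a).choose
  | .add s t => (s.eval β).bind fun a => (t.eval β).bind fun b => EffectAlgebra.oplus a b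

theorem oplus_choose (a : L) :
    oplus a (exists_unique_orthosupplement a).choose = some 1 :=
  (exists_unique_orthosupplement a).choose_spec.1

theorem eq_choose {a b : L} (h : oplus a b = some 1) :
    b = (exists_unique_orthosupplement a).choose :=
  (exists_unique_orthosupplement a).choose_spec.2 b h

theorem oplus_zero_one : oplus (1 : L) 0 = some 1 := by
  obtain ⟨a, ha, -⟩ := exists_unique_orthosupplement (1 : L)
  have := eq_zero_of_oplus_one (oplus_comm ha)
  rwa [this] at ha

theorem Term.eval_add {β : E → F → L} {s t : Term E F} {c : L} :
    (Term.add s t).eval β = some c ↔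
      ∃ a b, s.eval β = some a ∧ t.eval β = some b ∧ EffectAlgebra.oplus a b = some c := by
  simp [Term.eval, Option.bind_eq_some_iff]

theorem Term.eval_perp {β : E → F → L} {t : Term E F} {a : L} (h : t.eval β = some a) :
    t.perp.eval β = some (exists_unique_orthosupplement a).choose := by
  simp [Term.eval, h]

theorem Rel.eval {β : E → F → L} (hβ : IsBimorphism β) {s t : Term E F} (h : Rel s t) :
    ∃ a, s.eval β = some a ∧ t.eval β = some a := by
  induction h with
  | tmul e f => exact ⟨_, rfl, rfl⟩
  | one => exact ⟨_, rfl, rfl⟩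
  | symm _ ih => exact ih.imp fun _ h => h.symm
  | trans _ _ ih₁ ih₂ =>
    obtain ⟨a, h₁, h₂⟩ := ih₁
    obtain ⟨b, h₃, h₄⟩ := ih₂
    exact ⟨a, h₁, by rw [h₄, ← h₃, h₂]⟩
  | perp _ ih =>
    obtain ⟨a, h₁, h₂⟩ := ih
    exact ⟨_, Term.eval_perp h₁, Term.eval_perp h₂⟩
  | add _ _ _ ih₁ ih₂ ih₃ =>
    obtain ⟨a, h₁, h₁'⟩ := ih₁
    obtain ⟨b, h₂, h₂'⟩ := ih₂
    obtain ⟨c, h₃, -⟩ := ih₃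
    refine ⟨c, h₃, ?_⟩
    obtain ⟨a', b', ha, hb, h⟩ := Term.eval_add.1 h₃
    exact Term.eval_add.2 ⟨a', b', by rw [h₁', ← h₁, ha], by rw [h₂', ← h₂, hb], h⟩
  | left _ ih =>
    obtain ⟨c, h, -⟩ := ih
    obtain ⟨a, b, ha, -, -⟩ := Term.eval_add.1 h
    exact ⟨a, ha, ha⟩
  | of_perp _ ih =>
    obtain ⟨c, h, -⟩ := ih
    obtain ⟨a, ha, -⟩ := Option.map_eq_some_iff.1 h
    exact ⟨a, ha, ha⟩
  | comm _ ih =>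
    obtain ⟨c, h, -⟩ := ih
    obtain ⟨a, b, ha, hb, hab⟩ := Term.eval_add.1 h
    exact ⟨c, h, Term.eval_add.2 ⟨b, a, hb, ha, oplus_comm hab⟩⟩
  | assoc _ ih =>
    obtain ⟨e, h, -⟩ := ih
    obtain ⟨d, c, hd, hc, hdc⟩ := Term.eval_add.1 h
    obtain ⟨a, b, ha, hb, hab⟩ := Term.eval_add.1 hd
    obtain ⟨f, hbc, haf⟩ := oplus_assoc hab hdc
    exact ⟨e, h, Term.eval_add.2 ⟨a, f, ha, Term.eval_add.2 ⟨b, c, hb, hc, hbc⟩, haf⟩⟩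
  | add_perp _ ih =>
    obtain ⟨a, h, -⟩ := ih
    exact ⟨1, Term.eval_add.2 ⟨a, _, h, Term.eval_perp h, oplus_choose a⟩, rfl⟩
  | eq_perp _ ih =>
    obtain ⟨c, h, hc⟩ := ih
    obtain ⟨a, b, ha, hb, hab⟩ := Term.eval_add.1 h
    obtain rfl : 1 = c := Option.some.inj hc
    exact ⟨b, hb, by rw [Term.eval_perp ha, ← eq_choose hab]⟩
  | add_one _ ih =>
    obtain ⟨c, h, -⟩ := ih
    obtain ⟨a, b, ha, hb, hab⟩ := Term.eval_add.1 h
    obtain rfl : 1 = b := Option.some.inj hb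
    have h₁ : Term.eval β .one = some 1 := rfl
    refine ⟨a, ha, ?_⟩
    rw [Term.eval_perp h₁, ← eq_choose oplus_zero_one, eq_zero_of_oplus_one hab]
  | oplus_left q h => exact ⟨_, Term.eval_add.2 ⟨_, _, rfl, rfl, hβ.oplus_left q h⟩, rfl⟩
  | oplus_right p h => exact ⟨_, Term.eval_add.2 ⟨_, _, rfl, rfl, hβ.oplus_right p h⟩, rfl⟩
  | one_one => exact ⟨1, congrArg some hβ.map_one_one, rfl⟩

theorem exists_lift {β : E → F → L} (hβ : IsBimorphism β) :
    ∃ φ : Hom (Tensor E F) L, ∀ e f, φ (tmul e f) = β e f := by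
  have key : ∀ x : Tensor E F, ∃ a : L, ∀ t ht, x = Tensor.mk t ht → t.eval β = some a := by
    intro x
    induction x using Tensor.ind with | _ s hs
    obtain ⟨a, ha, -⟩ := hs.eval hβ
    refine ⟨a, fun t ht h => ?_⟩
    obtain ⟨b, hb, hb'⟩ := (Tensor.mk_eq.1 h).eval hβ
    rw [hb', ← hb, ha]
  choose φ hφ using key
  refine ⟨⟨φ, ?_, ?_⟩, fun e f => ?_⟩
  · exact (Option.some.inj (hφ 1 .one .one rfl)).symm
  · intro a b c
    induction a using Tensor.ind with | _ a ha
    induction b using Tensor.ind with | _ b hb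
    induction c using Tensor.ind with | _ c hc
    intro h
    obtain ⟨z, hz, hz'⟩ := (Tensor.oplus_mk.1 h).eval hβ
    obtain ⟨x, y, hx, hy, hxy⟩ := Term.eval_add.1 hz
    rw [hφ _ a ha rfl] at hx
    rw [hφ _ b hb rfl] at hy
    rw [hφ _ c hc rfl] at hz'
    rw [Option.some.inj hx, Option.some.inj hy, hxy, Option.some.inj hz']
  · exact (Option.some.inj (hφ (tmul e f) _ (.tmul e f) rfl)).symm

theorem Hom.ext_tmul {φ ψ : Hom (Tensor E F) L} (h : ∀ e f, φ (tmul e f) = ψ (tmul e f)) :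
    φ = ψ := by
  have key : ∀ (t : Term E F) (ht : Rel t t), φ (Tensor.mk t ht) = ψ (Tensor.mk t ht) := by
    intro t
    induction t with
    | tmul e f => exact fun _ => h e f
    | one => exact fun _ => φ.map_one'.trans ψ.map_one'.symm
    | perp t ih =>
      intro ht
      have h := Tensor.oplus_mk (hr := ht.of_perp) (hs := ht) (ht := .one) |>.2 ht.of_perp.add_perp
      have h₁ := φ.map_oplus' h
      have h₂ := ψ.map_oplus' h
      have e : φ.toFun _ = ψ.toFun _ := ih ht.of_perp
      have e₁ : φ.toFun (Tensor.mk .one .one) = 1 := φ.map_one'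
      have e₂ : ψ.toFun (Tensor.mk .one .one) = 1 := ψ.map_one'
      rw [e, e₁] at h₁
      rw [e₂] at h₂
      exact (eq_choose h₁).trans (eq_choose h₂).symm
    | add s t ihs iht =>
      intro ht
      have h₁ := φ.map_oplus' (Tensor.oplus_mk (hr := ht.left) (hs := ht.right) (ht := ht) |>.2 ht)
      have h₂ := ψ.map_oplus' (Tensor.oplus_mk (hr := ht.left) (hs := ht.right) (ht := ht) |>.2 ht)
      have e₁ : φ.toFun _ = ψ.toFun _ := ihs ht.left
      have e₂ : φ.toFun _ = ψ.toFun _ := iht ht.right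
      rw [e₁, e₂] at h₁
      exact Option.some.inj (h₁.symm.trans h₂)
  exact DFunLike.ext _ _ (Tensor.ind key)

/-- The universal property of the tensor product. -/
theorem isTensorProduct_tmul : IsTensorProduct.{u, v, max u v, x} (tmul : E → F → Tensor E F) :=
  ⟨isBimorphism_tmul, fun _ _ _ hβ => (exists_lift hβ).imp fun _ h =>
    ⟨h, fun _ h' => Hom.ext_tmul fun e f => (h' e f).trans (h e f).symm⟩⟩

end Construction

theorem exists_map {E : Type u} {F : Type v} {E' : Type w} {F' : Type x} [EffectAlgebra E]
    [EffectAlgebra F] [EffectAlgebra E'] [EffectAlgebra F'] (f : Hom E E') (g : Hom F F') :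
    ∃ φ : Hom (Tensor E F) (Tensor E' F'), ∀ a b, φ (tmul a b) = tmul (f a) (g b) :=
  exists_lift ⟨fun _ h => isBimorphism_tmul.oplus_left _ (f.map_oplus' h),
    fun _ _ _ _ h => isBimorphism_tmul.oplus_right _ (g.map_oplus' h), by
      have hf : f 1 = 1 := f.map_one'
      have hg : g 1 = 1 := g.map_one'
      rw [hf, hg, isBimorphism_tmul.map_one_one]⟩

/-- The morphism `f ⊗ g`, the unique one with `(f ⊗ g) (a ⊗ b) = f a ⊗ g b`. -/
noncomputable def tensorMap {E : Type u} {F : Type v} {E' : Type w} {F' : Type x}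
    [EffectAlgebra E] [EffectAlgebra F] [EffectAlgebra E'] [EffectAlgebra F']
    (f : Hom E E') (g : Hom F F') : Hom (Tensor E F) (Tensor E' F') :=
  (exists_map f g).choose

theorem tensorMap_tmul {E : Type u} {F : Type v} {E' : Type w} {F' : Type x}
    [EffectAlgebra E] [EffectAlgebra F] [EffectAlgebra E'] [EffectAlgebra F']
    (f : Hom E E') (g : Hom F F') (a : E) (b : F) :
    tensorMap f g (tmul a b) = tmul (f a) (g b) :=
  (exists_map f g).choose_spec a b

/-- The product `A_I ⊗ B_J` of two systems of effect algebras: the algebras `A i ⊗ B k`, indexed by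
`I × J` with the componentwise order, with the maps `f ⊗ g`. -/
noncomputable def tensorSystem {I J : Type u} [Preorder I] [Preorder J]
    {A : I → Type u} {B : J → Type u} [∀ i, EffectAlgebra (A i)] [∀ k, EffectAlgebra (B k)]
    (f : ∀ ⦃j i : I⦄, j ≤ i → Hom (A j) (A i)) (g : ∀ ⦃l k : J⦄, l ≤ k → Hom (B l) (B k))
    ⦃q p : I × J⦄ (h : q ≤ p) : Hom (Tensor (A q.1) (B q.2)) (Tensor (A p.1) (B p.2)) :=
  tensorMap (f h.1) (g h.2)

end EffectAlgebra

/-!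
The tensor product commutes with direct limits and preserves finiteness with Riesz decomposition.

*Simplicial algebras.* A sum in an effect algebra may be undefined, but adjoining an absorbing
element for undefined sums makes it a commutative monoid (`Total`), in which finite sums are
manipulated freely. In a simplicial effect algebra every element is a sum of atoms by finiteness,
and Riesz decomposition makes atoms prime, so the decomposition is unique: the atoms form a basis
(`IsSimplicial.exists_isBasis`). Conversely an effect algebra with a finite basis is an interval
`[0, u]` in some `ℤ^n`, hence finite with Riesz decomposition (`IsBasis.isSimplicial`). If `(eᵢ)`
and `(fⱼ)` are bases, then `1 = 1 ⊗ 1` is a sum of the `eᵢ ⊗ fⱼ` with multiplicities `uᵢ vⱼ`, so all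
linear combinations with smaller multiplicities are defined; products of coordinates define a
morphism from the tensor product to `[0, u ⊗ v]` whose inverse is given by these combinations.
Thus the `eᵢ ⊗ fⱼ` form a basis (`IsBasis.tmul`).

*Direct limits.* The direct limit of the underlying sets, with the sums that are defined at some
stage, is an effect algebra. Comparison with it shows that in any direct limit elements come from
stages (`IsDirectLimit.exists_eq`), and that equalities and sums already hold at some stage
(`IsDirectLimit.exists_map_eq`, `IsDirectLimit.exists_map_oplus`). Hence a compatible family of
bimorphisms on `A i × B k` induces a bimorphism on the limits
(`exists_bimorphism_of_compatible`), which is the universal property of the tensor product of the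
limits as a direct limit (`IsDirectLimit.tensor`).
-/

namespace EffectAlgebra

/-! ### Elementary laws -/

section Basic

variable {E : Type u} [EffectAlgebra E]

theorem oplus_zero (a : E) : oplus a 0 = some a := by
  obtain ⟨b, hb, -⟩ := exists_unique_orthosupplement a
  have hba := oplus_comm hb
  -- `a` is the orthosupplement of `b`, and `b ⊕ (a ⊕ 0) = 1 ⊕ 0 = 1`.
  obtain ⟨f, hf, hbf⟩ := oplus_assoc hba oplus_zero_one
  rwa [(exists_unique_orthosupplement b).unique hbf hba] at hf

theorem oplus_left_cancel {a b c d : E} (hb : oplus a b = some d) (hc : oplus a c = some d) :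
    b = c := by
  obtain ⟨d', hd, -⟩ := exists_unique_orthosupplement d
  -- Both `b` and `c` are orthosupplements of `a ⊕ d'`.
  obtain ⟨f, hf, hbf⟩ := oplus_assoc (oplus_comm hb) hd
  obtain ⟨f', hf', hcf⟩ := oplus_assoc (oplus_comm hc) hd
  obtain rfl : f = f' := Option.some.inj (hf.symm.trans hf')
  exact (exists_unique_orthosupplement f).unique (oplus_comm hbf) (oplus_comm hcf)

theorem eq_zero_of_oplus_eq_zero {a b : E} (h : oplus a b = some 0) : a = 0 := by
  obtain ⟨f, hf, -⟩ := oplus_assoc (oplus_comm h) (oplus_comm oplus_zero_one)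
  exact eq_zero_of_oplus_one hf

end Basic

namespace Hom

variable {E : Type u} {F : Type v} {G : Type w} [EffectAlgebra E] [EffectAlgebra F]
  [EffectAlgebra G]

theorem map_one (φ : Hom E F) : φ 1 = 1 := φ.map_one'

theorem map_oplus (φ : Hom E F) {a b c : E} (h : oplus a b = some c) :
    oplus (φ a) (φ b) = some (φ c) :=
  φ.map_oplus' h

theorem map_zero (φ : Hom E F) : φ 0 = 0 :=
  oplus_left_cancel (φ.map_oplus (oplus_zero 0)) (oplus_zero (φ 0))

variable (E) in
/-- The identity morphism. -/
def id : Hom E E := ⟨fun a => a, rfl, fun h => h⟩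

/-- The composite of two morphisms. -/
def comp (ψ : Hom F G) (φ : Hom E F) : Hom E G where
  toFun a := ψ (φ a)
  map_one' := by rw [φ.map_one, ψ.map_one]
  map_oplus' h := ψ.map_oplus (φ.map_oplus h)

theorem comp_apply (ψ : Hom F G) (φ : Hom E F) (a : E) : ψ.comp φ a = ψ (φ a) := rfl

end Hom

/-! ### The total monoid of an effect algebra -/

/-- The commutative monoid obtained from an effect algebra by adjoining an absorbing element
`none`, the value of all undefined sums. Finite sums in `E` are computed as sums in `Total E`. -/
def Total (E : Type u) : Type u := Option E

namespace Total

/-- The inclusion of an effect algebra into its total monoid. -/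
def of {E : Type u} (a : E) : Total E := some a

theorem of_injective {E : Type u} : Function.Injective (of : E → Total E) :=
  fun _ _ h => Option.some.inj h

theorem ext_of {E : Type u} {x y : Total E} (h : ∀ c, x = of c ↔ y = of c) : x = y :=
  Option.ext h

section

variable {E : Type u} [EffectAlgebra E]

instance : Zero (Total E) := ⟨of 0⟩

instance : Add (Total E) :=
  ⟨fun x y => Option.bind x fun a => Option.bind y fun b => oplus a b⟩

theorem add_eq_of {x y : Total E} {c : E} :
    x + y = of c ↔ ∃ a b, x = of a ∧ y = of b ∧ oplus a b = some c := by
  constructor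
  · intro h
    obtain ⟨a, ha, h⟩ := Option.bind_eq_some_iff.1 h
    obtain ⟨b, hb, h⟩ := Option.bind_eq_some_iff.1 h
    exact ⟨a, b, ha, hb, h⟩
  · rintro ⟨a, b, rfl, rfl, h⟩
    exact h

theorem of_add_of {a b c : E} : of a + of b = of c ↔ oplus a b = some c :=
  Iff.rfl

theorem add_comm_of {x y : Total E} {c : E} (h : x + y = of c) : y + x = of c := by
  obtain ⟨a, b, rfl, rfl, h⟩ := add_eq_of.1 h
  exact add_eq_of.2 ⟨b, a, rfl, rfl, oplus_comm h⟩

theorem add_assoc_of {x y z : Total E} {e : E} (h : x + y + z = of e) :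
    x + (y + z) = of e := by
  obtain ⟨d, c, hd, rfl, hdc⟩ := add_eq_of.1 h
  obtain ⟨a, b, rfl, rfl, hab⟩ := add_eq_of.1 hd
  obtain ⟨f, hf, haf⟩ := oplus_assoc hab hdc
  exact add_eq_of.2 ⟨a, f, rfl, add_eq_of.2 ⟨b, c, rfl, rfl, hf⟩, haf⟩

theorem add_comm' (x y : Total E) : x + y = y + x :=
  ext_of fun _ => ⟨add_comm_of, add_comm_of⟩

theorem add_assoc' (x y z : Total E) : x + y + z = x + (y + z) := by
  refine ext_of fun c => ⟨add_assoc_of, fun h => ?_⟩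
  rw [add_comm' x, add_comm' y] at h
  rw [add_comm' (x + y), add_comm' x]
  exact add_assoc_of h

theorem add_zero' (x : Total E) : x + 0 = x := by
  refine ext_of fun c => ⟨fun h => ?_, ?_⟩
  · obtain ⟨a, b, rfl, hb, h⟩ := add_eq_of.1 h
    rw [← of_injective hb, oplus_zero] at h
    exact h
  · rintro rfl
    exact oplus_zero c

instance : AddCommMonoid (Total E) where
  add_assoc := add_assoc'
  zero_add x := (add_comm' _ _).trans (add_zero' x)
  add_zero := add_zero'
  add_comm := add_comm'
  nsmul := nsmulRec

theorem of_zero : of (0 : E) = 0 := rfl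

/-- A summand of a defined sum is defined. -/
theorem eq_of_of_add {x y : Total E} {c : E} (h : x + y = of c) : ∃ a, x = of a :=
  let ⟨a, _, ha, _⟩ := add_eq_of.1 h
  ⟨a, ha⟩

theorem add_left_cancel_of {x y z : Total E} {c : E} (hy : x + y = of c) (hz : x + z = of c) :
    y = z := by
  obtain ⟨a, b, rfl, rfl, hb⟩ := add_eq_of.1 hy
  obtain ⟨a', b', ha, rfl, hb'⟩ := add_eq_of.1 hz
  obtain rfl := of_injective ha
  rw [oplus_left_cancel hb hb']

end

/-- Maps which carry defined sums to sums carry defined linear combinations to linear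
combinations. -/
theorem sum_map {E : Type u} {M : Type v} [EffectAlgebra E] [AddCommMonoid M] {g : E → M}
    (zero : g 0 = 0) (add : ∀ {a b c : E}, oplus a b = some c → g a + g b = g c)
    {ι : Type w} (s : Finset ι) (m : ι → ℕ) (e : ι → E) {x : E}
    (h : ∑ i ∈ s, m i • of (e i) = of x) : ∑ i ∈ s, m i • g (e i) = g x := by
  have nsmul : ∀ (n : ℕ) (a x : E), n • of a = of x → n • g a = g x := by
    intro n a
    induction n with
    | zero =>
      intro x hx
      rw [zero_nsmul, ← of_zero] at hx
      rw [zero_nsmul, ← of_injective hx, zero]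
    | succ n ih =>
      intro x hx
      rw [succ_nsmul] at hx ⊢
      obtain ⟨y, z, hy, hz, hyz⟩ := add_eq_of.1 hx
      obtain rfl := of_injective hz
      rw [ih y hy, add hyz]
  classical
  induction s using Finset.induction_on generalizing x with
  | empty =>
    rw [Finset.sum_empty, ← of_zero] at h
    rw [Finset.sum_empty, ← of_injective h, zero]
  | insert i s hi ih =>
    rw [Finset.sum_insert hi] at h ⊢
    obtain ⟨y, z, hy, hz, hyz⟩ := add_eq_of.1 h
    rw [nsmul _ _ _ hy, ih hz, add hyz]

/-- Maps between effect algebras which preserve defined sums, such as the partial maps of a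
bimorphism, preserve defined linear combinations. -/
theorem sum_map_of {E : Type u} {L : Type v} [EffectAlgebra E] [EffectAlgebra L] {g : E → L}
    (hg : ∀ {a b c : E}, oplus a b = some c → oplus (g a) (g b) = some (g c))
    {ι : Type w} (s : Finset ι) (m : ι → ℕ) (e : ι → E) {x : E}
    (h : ∑ i ∈ s, m i • of (e i) = of x) : ∑ i ∈ s, m i • of (g (e i)) = of (g x) := by
  refine sum_map (g := fun a => of (g a)) ?_ (fun h => of_add_of.2 (hg h)) s m e h
  rw [← of_zero, oplus_left_cancel (hg (oplus_zero 0)) (oplus_zero (g 0))]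

end Total

open Total

/-! ### Bases and simplicial effect algebras -/

/-- A finite family `e` is a basis of an effect algebra if every element is a linear combination
`⊕ mᵢ eᵢ` with unique multiplicities `mᵢ ∈ ℕ`. -/
def IsBasis {E : Type u} [EffectAlgebra E] {ι : Type w} [Fintype ι] (e : ι → E) : Prop :=
  ∀ x : E, ∃! m : ι → ℕ, ∑ i, m i • of (e i) = of x

namespace IsBasis

variable {E : Type u} [EffectAlgebra E] {ι : Type w} [Fintype ι] {e : ι → E}

/-- The coordinates of an element with respect to a basis. -/
noncomputable def coord (h : IsBasis e) (x : E) : ι → ℕ := (h x).choose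

theorem sum_coord (h : IsBasis e) (x : E) : ∑ i, h.coord x i • of (e i) = of x :=
  (h x).choose_spec.1

theorem eq_coord (h : IsBasis e) {x : E} {m : ι → ℕ} (hm : ∑ i, m i • of (e i) = of x) :
    m = h.coord x :=
  (h x).choose_spec.2 m hm

theorem coord_injective (h : IsBasis e) : Function.Injective h.coord := fun x y hxy =>
  of_injective (by rw [← h.sum_coord x, hxy, h.sum_coord])

theorem oplus_eq_some (h : IsBasis e) {a b c : E} :
    oplus a b = some c ↔ h.coord a + h.coord b = h.coord c := by
  have key : ∑ i, (h.coord a + h.coord b) i • of (e i) = of a + of b := by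
    simp only [Pi.add_apply, add_nsmul, Finset.sum_add_distrib, h.sum_coord]
  rw [← of_add_of, ← key]
  exact ⟨h.eq_coord, fun hc => by rw [hc, h.sum_coord]⟩

theorem exists_coord_eq (h : IsBasis e) {m : ι → ℕ} {x : E} (hm : m ≤ h.coord x) :
    ∃ a, h.coord a = m := by
  have hx := h.sum_coord x
  rw [← add_tsub_cancel_of_le hm] at hx
  simp only [Pi.add_apply, add_nsmul, Finset.sum_add_distrib] at hx
  obtain ⟨a, ha⟩ := eq_of_of_add hx
  exact ⟨a, (h.eq_coord ha).symm⟩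

theorem coord_le_one (h : IsBasis e) (x : E) : h.coord x ≤ h.coord 1 := by
  obtain ⟨y, hy, -⟩ := exists_unique_orthosupplement x
  rw [← h.oplus_eq_some.1 hy]
  exact le_self_add

theorem coord_basis (h : IsBasis e) [DecidableEq ι] (i : ι) : h.coord (e i) = Pi.single i 1 :=
  (h.eq_coord (by simp [Pi.single_apply, ite_smul])).symm

/-- In coordinates the Riesz decomposition is `c₁₁ = a₁ ⊓ b₁`. -/
theorem isSimplicial (h : IsBasis e) : IsSimplicial E := by
  constructor
  · have : Finite (Set.Iic (h.coord 1)) := by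
      classical exact Set.finite_Iic _
    exact Finite.of_injective (fun x => (⟨h.coord x, h.coord_le_one x⟩ : Set.Iic (h.coord 1)))
      fun x y hxy => h.coord_injective (congrArg Subtype.val hxy)
  · intro a₁ a₂ b₁ b₂ s ha hb
    rw [h.oplus_eq_some] at ha hb
    have hab := ha.trans hb.symm
    obtain ⟨c₁₁, h₁₁⟩ := h.exists_coord_eq (m := h.coord a₁ ⊓ h.coord b₁) inf_le_left
    obtain ⟨c₁₂, h₁₂⟩ := h.exists_coord_eq (m := h.coord a₁ - h.coord b₁) tsub_le_self
    obtain ⟨c₂₁, h₂₁⟩ := h.exists_coord_eq (m := h.coord b₁ - h.coord a₁) tsub_le_self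
    obtain ⟨c₂₂, h₂₂⟩ := h.exists_coord_eq
      (m := h.coord a₂ - (h.coord b₁ - h.coord a₁)) tsub_le_self
    refine ⟨c₁₁, c₁₂, c₂₁, c₂₂, ?_⟩
    simp only [h.oplus_eq_some, h₁₁, h₁₂, h₂₁, h₂₂]
    refine ⟨?_, ?_, ?_, ?_⟩ <;> ext i <;>
      (have := congrFun hab i
       simp only [Pi.add_apply, Pi.inf_apply, Pi.sub_apply] at *
       omega)

end IsBasis

section Atoms

variable (E : Type u) [EffectAlgebra E]

/-- The atoms of an effect algebra: the nonzero elements which are not sums of two nonzero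
elements. -/
abbrev Atom : Type u := {a : E // a ≠ 0 ∧ ∀ b c : E, oplus b c = some a → b = 0 ∨ c = 0}

variable {E}

/-- Induction along the strict order `b < b ⊕ c`, `c ≠ 0`, which is well-founded by finiteness. -/
theorem exists_sum_atoms [Finite E] (x : E) :
    ∃ s : Multiset (Atom E), (s.map fun a => of a.1).sum = of x := by
  let r : E → E → Prop := fun b x => ∃ c, c ≠ 0 ∧ oplus b c = some x
  have irrefl : Std.Irrefl r :=
    ⟨fun x ⟨c, hc, h⟩ => hc (oplus_left_cancel h (oplus_zero x))⟩
  have trans : IsTrans E r := by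
    refine ⟨fun a b c => ?_⟩
    rintro ⟨d, hd, hab⟩ ⟨d', -, hbc⟩
    obtain ⟨f, hf, haf⟩ := oplus_assoc hab hbc
    refine ⟨f, ?_, haf⟩
    rintro rfl
    exact hd (eq_zero_of_oplus_eq_zero hf)
  induction x using (Finite.wellFounded_of_trans_of_irrefl r).induction with | _ x ih
  by_cases hx : x = 0
  · exact ⟨0, by rw [hx]; rfl⟩
  by_cases hx' : ∀ b c : E, oplus b c = some x → b = 0 ∨ c = 0
  · exact ⟨{⟨x, hx, hx'⟩}, by rw [Multiset.map_singleton, Multiset.sum_singleton]⟩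
  push Not at hx'
  obtain ⟨b, c, h, hb, hc⟩ := hx'
  obtain ⟨s, hs⟩ := ih b ⟨c, hc, h⟩
  obtain ⟨t, ht⟩ := ih c ⟨b, hb, oplus_comm h⟩
  exact ⟨s + t, by rw [Multiset.map_add, Multiset.sum_add, hs, ht]; exact h⟩

/-- By the Riesz decomposition property atoms are prime: an atom below a sum of atoms is one of
them. -/
theorem mem_of_atom_add_eq (hE : HasRDP E) (a : Atom E) (s : Multiset (Atom E)) {y : Total E}
    {x : E} (hy : of a.1 + y = of x) (hs : (s.map fun a => of a.1).sum = of x) : a ∈ s := by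
  induction s using Multiset.induction_on generalizing x y with
  | empty =>
    rw [Multiset.map_zero, Multiset.sum_zero, ← of_zero] at hs
    obtain rfl := of_injective hs
    obtain ⟨a', b, ha, -, h⟩ := add_eq_of.1 hy
    obtain rfl := of_injective ha
    exact absurd (eq_zero_of_oplus_eq_zero h) a.2.1
  | cons b s ih =>
    rw [Multiset.map_cons, Multiset.sum_cons] at hs
    obtain ⟨a', d, ha, -, had⟩ := add_eq_of.1 hy
    obtain rfl := of_injective ha
    obtain ⟨b', z, hb, hz, hbz⟩ := add_eq_of.1 hs
    obtain rfl := of_injective hb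
    obtain ⟨c₁₁, c₁₂, c₂₁, c₂₂, h₁, -, h₃, h₄⟩ := hE _ _ _ _ _ had hbz
    rw [Multiset.mem_cons]
    rcases a.2.2 _ _ h₁ with rfl | rfl
    · right
      rw [← of_add_of, of_zero, zero_add] at h₁
      obtain rfl := of_injective h₁
      exact ih (of_add_of.2 h₄) hz
    · left
      rw [oplus_zero] at h₁
      obtain rfl := Option.some.inj h₁
      rcases b.2.2 _ _ h₃ with h | rfl
      · exact absurd h a.2.1
      · rw [oplus_zero] at h₃
        exact Subtype.ext (Option.some.inj h₃)

theorem eq_of_sum_atoms_eq (hE : HasRDP E) (s t : Multiset (Atom E)) {x : E}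
    (hs : (s.map fun a => of a.1).sum = of x) (ht : (t.map fun a => of a.1).sum = of x) :
    s = t := by
  induction s using Multiset.induction_on generalizing t x with
  | empty =>
    rw [Multiset.map_zero, Multiset.sum_zero, ← of_zero] at hs
    obtain rfl := of_injective hs
    refine (Multiset.eq_zero_of_forall_notMem fun b hb => ?_).symm
    obtain ⟨t', rfl⟩ := Multiset.exists_cons_of_mem hb
    rw [Multiset.map_cons, Multiset.sum_cons] at ht
    obtain ⟨b', z, hb', -, h⟩ := add_eq_of.1 ht
    obtain rfl := of_injective hb'
    exact b.2.1 (eq_zero_of_oplus_eq_zero h)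
  | cons a s ih =>
    rw [Multiset.map_cons, Multiset.sum_cons] at hs
    obtain ⟨t', rfl⟩ := Multiset.exists_cons_of_mem (mem_of_atom_add_eq hE a t hs ht)
    rw [Multiset.map_cons, Multiset.sum_cons] at ht
    obtain ⟨-, z, -, hz, -⟩ := add_eq_of.1 hs
    rw [ih t' hz (by rw [← hz]; exact add_left_cancel_of ht hs)]

/-- The atoms of a simplicial effect algebra form a basis. -/
theorem IsSimplicial.exists_isBasis (hE : IsSimplicial E) :
    ∃ (ι : Type u) (_ : Fintype ι) (e : ι → E), IsBasis e := by
  classical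
  obtain ⟨hfin, hrdp⟩ := hE
  have : Finite (Atom E) := Subtype.finite
  let _ : Fintype (Atom E) := Fintype.ofFinite _
  refine ⟨Atom E, inferInstance, fun a => a.1, fun x => ?_⟩
  obtain ⟨s, hs⟩ := exists_sum_atoms x
  refine ⟨fun a => s.count a, ?_, fun m hm => ?_⟩
  · rw [← hs, Finset.sum_multiset_map_count]
    refine (Finset.sum_subset (Finset.subset_univ _) fun a _ ha => ?_).symm
    simp only [Multiset.count_eq_zero.2 (mt Multiset.mem_toFinset.2 ha), zero_nsmul]
  · have key : ((∑ a, Multiset.replicate (m a) a).map fun a : Atom E => of a.1).sum = of x := by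
      rw [← hm, ← Multiset.coe_mapAddMonoidHom, map_sum, Multiset.sum_sum]
      simp
    rw [eq_of_sum_atoms_eq hrdp s _ hs key]
    ext a
    simp [Multiset.count_sum', Multiset.count_replicate]

end Atoms

/-! ### The tensor product of simplicial effect algebras -/

/-- The interval `[0, w]` of the simplicial group `ℤ^ι`, an effect algebra under the restriction of
addition to the pairs whose sum lies in the interval. -/
@[ext]
structure Box {ι : Type w} (w : ι → ℕ) : Type w where
  val : ι → ℕ
  le : val ≤ w

namespace Box

variable {ι : Type w} {w : ι → ℕ}

instance : Zero (Box w) := ⟨⟨0, fun _ => Nat.zero_le _⟩⟩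

instance : One (Box w) := ⟨⟨w, le_rfl⟩⟩

open Classical in
/-- The sum of two elements of the interval, if it lies in the interval. -/
noncomputable def oplus (m n : Box w) : Option (Box w) :=
  if h : m.1 + n.1 ≤ w then some ⟨m.1 + n.1, h⟩ else none

theorem oplus_eq_some {m n p : Box w} : oplus m n = some p ↔ m.1 + n.1 = p.1 := by
  unfold oplus
  split_ifs with h
  · rw [Option.some.injEq]
    exact Box.ext_iff
  · exact ⟨fun h' => by simp at h', fun h' => absurd (h' ▸ p.le) h⟩

noncomputable instance : EffectAlgebra (Box w) where
  oplus := oplus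
  oplus_comm h := by
    rw [oplus_eq_some] at h ⊢
    rwa [add_comm]
  oplus_assoc {a b c d e} h₁ h₂ := by
    simp only [oplus_eq_some] at h₁ h₂ ⊢
    rw [← h₁, add_assoc] at h₂
    refine ⟨⟨b.1 + c.1, (le_add_self.trans h₂.le).trans e.le⟩, rfl, h₂⟩
  exists_unique_orthosupplement a := by
    refine ⟨⟨w - a.1, tsub_le_self⟩, oplus_eq_some.2 (add_tsub_cancel_of_le a.le), fun b hb => ?_⟩
    refine Box.ext (add_left_cancel (a := a.1) ?_)
    exact (oplus_eq_some.1 hb).trans (add_tsub_cancel_of_le a.le).symm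
  eq_zero_of_oplus_one {a c} h := by
    have h := (oplus_eq_some.1 h).trans_le c.le
    exact Box.ext (funext fun i => by
      have hi : a.val i + w i ≤ w i := h i
      have h0 : a.val i = 0 := by omega
      exact h0)

end Box

section TensorBasis

variable {E : Type u} {F : Type v} [EffectAlgebra E] [EffectAlgebra F]
  {ι : Type w} {κ : Type x} [Fintype ι] [Fintype κ] {e : ι → E} {f : κ → F}

theorem sum_tmul (he : IsBasis e) (hf : IsBasis f) (x : E) (y : F) :
    ∑ p : ι × κ, (he.coord x p.1 * hf.coord y p.2) • of (tmul (e p.1) (f p.2)) =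
      of (tmul x y) := by
  rw [Fintype.sum_prod_type, ← sum_map_of (g := fun a => tmul a y)
    (isBimorphism_tmul.oplus_left y) _ _ _ (he.sum_coord x)]
  refine Finset.sum_congr rfl fun i _ => ?_
  rw [← sum_map_of (g := tmul (e i)) (isBimorphism_tmul.oplus_right _) _ _ _ (hf.sum_coord y),
    Finset.smul_sum]
  exact Finset.sum_congr rfl fun j _ => mul_nsmul' _ _ _

/-- The tensors of the elements of two bases form a basis of the tensor product. Coordinates are
given by the morphism to the interval `[0, u ⊗ v]` induced by the products of coordinates. -/
theorem IsBasis.tmul (he : IsBasis e) (hf : IsBasis f) :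
    IsBasis fun p : ι × κ => tmul (e p.1) (f p.2) := by
  classical
  let w : ι × κ → ℕ := fun p => he.coord 1 p.1 * hf.coord 1 p.2
  let β : E → F → Box w := fun x y => ⟨fun p => he.coord x p.1 * hf.coord y p.2,
    fun p => Nat.mul_le_mul (he.coord_le_one x p.1) (hf.coord_le_one y p.2)⟩
  have hβ : IsBimorphism β :=
    { oplus_left := fun q h => Box.oplus_eq_some.2 <| funext fun p => by
        simp only [β, ← he.oplus_eq_some.1 h, Pi.add_apply, add_mul]
      oplus_right := fun p _ _ _ h => Box.oplus_eq_some.2 <| funext fun p => by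
        simp only [β, ← hf.oplus_eq_some.1 h, Pi.add_apply, mul_add]
      map_one_one := rfl }
  obtain ⟨χ, hχ⟩ := exists_lift hβ
  have χ_one : χ 1 = 1 := χ.map_one
  have χ_add : ∀ {a b c : Tensor E F}, oplus a b = some c → (χ a).1 + (χ b).1 = (χ c).1 :=
    fun h => Box.oplus_eq_some.1 (χ.map_oplus h)
  have χ_zero : (χ 0).1 = 0 := by simpa using χ_add (oplus_zero 0)
  have sum_w : ∑ p, w p • of (EffectAlgebra.tmul (e p.1) (f p.2)) = of 1 :=
    (sum_tmul he hf 1 1).trans (congrArg of isBimorphism_tmul.map_one_one)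
  -- All linear combinations with multiplicities at most `w` are defined.
  have key : ∀ m : Box w, ∃ t, ∑ p, m.1 p • of (EffectAlgebra.tmul (e p.1) (f p.2)) = of t := by
    intro m
    have h := sum_w
    rw [← add_tsub_cancel_of_le m.le] at h
    simp only [Pi.add_apply, add_nsmul, Finset.sum_add_distrib] at h
    exact eq_of_of_add h
  choose ψ hψ using key
  let θ : Hom (Tensor E F) (Tensor E F) :=
    { toFun := fun t => ψ (χ t)
      map_one' := of_injective ((hψ _).symm.trans (by rw [χ_one]; exact sum_w))
      map_oplus' := fun h => by
        rw [← of_add_of, ← hψ, ← hψ, ← hψ, ← χ_add h]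
        simp only [Pi.add_apply, add_nsmul, Finset.sum_add_distrib] }
  -- The composite of the two maps fixes the elements `x ⊗ y`, hence is the identity.
  have hθ : θ = Hom.id _ := Hom.ext_tmul fun x y =>
    of_injective ((hψ _).symm.trans (by rw [hχ]; exact sum_tmul he hf x y))
  refine fun t => ⟨(χ t).1, (hψ _).trans (congrArg of (DFunLike.congr_fun hθ t)), fun m hm => ?_⟩
  rw [← sum_map (g := fun t => (χ t).1) χ_zero χ_add _ _ _ hm]
  funext q
  simp [hχ, β, he.coord_basis, hf.coord_basis, Pi.single_apply, Fintype.sum_prod_type]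

theorem IsSimplicial.tensor (hE : IsSimplicial E) (hF : IsSimplicial F) :
    IsSimplicial (Tensor E F) := by
  obtain ⟨ι, _, e, he⟩ := hE.exists_isBasis
  obtain ⟨κ, _, f, hf⟩ := hF.exists_isBasis
  exact (he.tmul hf).isSimplicial

end TensorBasis

/-! ### Direct limits of effect algebras -/

namespace DirectLimit

variable {I : Type u} [Preorder I] {A : I → Type v} [∀ i, EffectAlgebra (A i)]
  (f : ∀ ⦃j i : I⦄, j ≤ i → Hom (A j) (A i)) [DirectedSystem A (fun _ _ h => f h)]

theorem map_map {i j k : I} (hij : i ≤ j) (hjk : j ≤ k) (a : A i) :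
    f hjk (f hij a) = f (hij.trans hjk) a :=
  DirectedSystem.map_map (f := fun _ _ h => f h) hij hjk a

variable [IsDirectedOrder I]

/-- The direct limit of the underlying sets of a directed system of effect algebras. -/
def Carrier : Type (max u v) := DirectLimit A (fun _ _ h => f h)

variable {f}

/-- The class in the limit of an element at stage `i`. -/
def mk (i : I) (a : A i) : Carrier f := Quotient.mk (DirectLimit.setoid _) ⟨i, a⟩

theorem mk_eq {i j : I} {a : A i} {b : A j} :
    (mk i a : Carrier f) = mk j b ↔ ∃ (k : I) (hi : i ≤ k) (hj : j ≤ k), f hi a = f hj b :=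
  Quotient.eq (r := DirectLimit.setoid _)

theorem exists_mk_eq (x : Carrier f) : ∃ i a, mk i a = x :=
  let ⟨i, a, h⟩ := DirectLimit.exists_eq_mk (fun _ _ h => f h) x
  ⟨i, a, h.symm⟩

theorem mk_map {i j : I} (h : i ≤ j) (a : A i) : (mk j (f h a) : Carrier f) = mk i a :=
  mk_eq.2 ⟨j, le_rfl, h, by rw [map_map]⟩

/-- `x ⊕ y = z` holds at some stage of the system. -/
def IsSum (x y z : Carrier f) : Prop :=
  ∃ (i : I) (a b c : A i), mk i a = x ∧ mk i b = y ∧ mk i c = z ∧ oplus a b = some c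

/-- A sum in the limit is witnessed at some stage beyond any stages at which the summands and the
value are given. -/
theorem IsSum.exists_stage {i j k : I} {a : A i} {b : A j} {c : A k}
    (h : IsSum (f := f) (mk i a) (mk j b) (mk k c)) :
    ∃ (l : I) (hi : i ≤ l) (hj : j ≤ l) (hk : k ≤ l),
      oplus (f hi a) (f hj b) = some (f hk c) := by
  obtain ⟨m, a', b', c', ha, hb, hc, h⟩ := h
  obtain ⟨p, hp, hp', hpa⟩ := mk_eq.1 ha
  obtain ⟨q, hq, hq', hqb⟩ := mk_eq.1 hb
  obtain ⟨r, hr, hr', hrc⟩ := mk_eq.1 hc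
  obtain ⟨l, hpl, hql, hrl⟩ := directed_of₃ (· ≤ ·) p q r
  refine ⟨l, hp'.trans hpl, hq'.trans hql, hr'.trans hrl, ?_⟩
  rw [← map_map f hp' hpl, ← map_map f hq' hql, ← map_map f hr' hrl, ← hpa, ← hqb, ← hrc,
    map_map, map_map, map_map]
  exact (f (hp.trans hpl)).map_oplus h

theorem IsSum.unique {x y z z' : Carrier f} (h : IsSum x y z) (h' : IsSum x y z') : z = z' := by
  obtain ⟨i, a, b, c, rfl, rfl, rfl, h⟩ := h
  obtain ⟨j, c', rfl⟩ := exists_mk_eq z'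
  obtain ⟨l, hi, hi', hj, h'⟩ := h'.exists_stage
  exact mk_eq.2 ⟨l, hi, hj, Option.some.inj (((f hi).map_oplus h).symm.trans h')⟩

open Classical in
/-- The partial sum on the direct limit. -/
noncomputable def sum (x y : Carrier f) : Option (Carrier f) :=
  if h : ∃ z, IsSum x y z then some h.choose else none

theorem sum_eq_some {x y z : Carrier f} : sum x y = some z ↔ IsSum x y z := by
  unfold sum
  split_ifs with h
  · rw [Option.some.injEq]
    exact ⟨fun hz => hz ▸ h.choose_spec, h.choose_spec.unique⟩
  · exact ⟨fun h' => by simp at h', fun h' => absurd ⟨z, h'⟩ h⟩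

variable [Nonempty I]

noncomputable instance : Zero (Carrier f) := ⟨mk (Classical.arbitrary I) 0⟩

noncomputable instance : One (Carrier f) := ⟨mk (Classical.arbitrary I) 1⟩

theorem mk_zero (i : I) : (mk i 0 : Carrier f) = 0 := by
  obtain ⟨k, hi, hj⟩ := exists_ge_ge i (Classical.arbitrary I)
  exact mk_eq.2 ⟨k, hi, hj, (f hi).map_zero.trans (f hj).map_zero.symm⟩

theorem mk_one (i : I) : (mk i 1 : Carrier f) = 1 := by
  obtain ⟨k, hi, hj⟩ := exists_ge_ge i (Classical.arbitrary I)
  exact mk_eq.2 ⟨k, hi, hj, (f hi).map_one.trans (f hj).map_one.symm⟩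

noncomputable instance : EffectAlgebra (Carrier f) where
  oplus := sum
  oplus_comm h := by
    rw [sum_eq_some] at h ⊢
    obtain ⟨i, a, b, c, ha, hb, hc, h⟩ := h
    exact ⟨i, b, a, c, hb, ha, hc, EffectAlgebra.oplus_comm h⟩
  oplus_assoc {x y z s t} h₁ h₂ := by
    simp only [sum_eq_some] at h₁ h₂ ⊢
    obtain ⟨i, a, b, d, rfl, rfl, rfl, h₁⟩ := h₁
    obtain ⟨j, c, rfl⟩ := exists_mk_eq z
    obtain ⟨k, e, rfl⟩ := exists_mk_eq t
    obtain ⟨l, hi, hj, hk, h₂⟩ := h₂.exists_stage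
    obtain ⟨g, hg, hag⟩ := EffectAlgebra.oplus_assoc ((f hi).map_oplus h₁) h₂
    exact ⟨mk l g, ⟨l, _, _, _, mk_map hi b, mk_map hj c, rfl, hg⟩,
      ⟨l, _, _, _, mk_map hi a, rfl, mk_map hk e, hag⟩⟩
  exists_unique_orthosupplement x := by
    obtain ⟨i, a, rfl⟩ := exists_mk_eq x
    obtain ⟨a', ha', -⟩ := EffectAlgebra.exists_unique_orthosupplement a
    refine ⟨mk i a', sum_eq_some.2 ⟨i, a, a', 1, rfl, rfl, mk_one i, ha'⟩, fun y hy => ?_⟩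
    obtain ⟨j, b, rfl⟩ := exists_mk_eq y
    rw [sum_eq_some, ← mk_one i] at hy
    obtain ⟨l, hi, hj, hi', h⟩ := hy.exists_stage
    exact mk_eq.2 ⟨l, hj, hi, oplus_left_cancel h ((f hi).map_oplus ha')⟩
  eq_zero_of_oplus_one {x y} h := by
    obtain ⟨i, a, rfl⟩ := exists_mk_eq x
    obtain ⟨j, c, rfl⟩ := exists_mk_eq y
    rw [sum_eq_some, ← mk_one i] at h
    obtain ⟨l, hi, hi', hj, h⟩ := h.exists_stage
    rw [(f hi').map_one] at h
    rw [← mk_map hi a, EffectAlgebra.eq_zero_of_oplus_one h, mk_zero]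

variable (f) in
/-- The canonical morphism from stage `i` to the limit. -/
def of (i : I) : Hom (A i) (Carrier f) where
  toFun := mk i
  map_one' := mk_one i
  map_oplus' h := sum_eq_some.2 ⟨i, _, _, _, rfl, rfl, rfl, h⟩

end DirectLimit

namespace IsDirectLimit

variable {I : Type u} [Preorder I] [IsDirectedOrder I] [Nonempty I]
  {A : I → Type u} [∀ i, EffectAlgebra (A i)]
  {f : ∀ ⦃j i : I⦄, j ≤ i → Hom (A j) (A i)} [DirectedSystem A (fun _ _ h => f h)]
  {L : Type u} [EffectAlgebra L] {φ : ∀ i, Hom (A i) L}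

/-- The comparison morphism to the direct limit constructed from the underlying sets. -/
theorem exists_comparison (hφ : IsDirectLimit f φ) :
    ∃ χ : Hom L (DirectLimit.Carrier f), ∀ (i : I) (a : A i), χ (φ i a) = DirectLimit.mk i a :=
  (hφ.universal _ (DirectLimit.of f) fun _ _ h a => DirectLimit.mk_map h a).exists

/-- Elements with the same image in a direct limit are identified at some stage. -/
theorem exists_map_eq (hφ : IsDirectLimit f φ) {i j : I} {a : A i} {b : A j}
    (h : φ i a = φ j b) : ∃ (k : I) (hi : i ≤ k) (hj : j ≤ k), f hi a = f hj b := by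
  obtain ⟨χ, hχ⟩ := hφ.exists_comparison
  exact DirectLimit.mk_eq.1 (by rw [← hχ, h, hχ])

/-- Sums in a direct limit are already defined at some stage. -/
theorem exists_map_oplus (hφ : IsDirectLimit f φ) {i j k : I} {a : A i} {b : A j} {c : A k}
    (h : oplus (φ i a) (φ j b) = some (φ k c)) :
    ∃ (l : I) (hi : i ≤ l) (hj : j ≤ l) (hk : k ≤ l),
      oplus (f hi a) (f hj b) = some (f hk c) := by
  obtain ⟨χ, hχ⟩ := hφ.exists_comparison
  have h' : oplus (χ (φ i a)) (χ (φ j b)) = some (χ (φ k c)) := χ.map_oplus h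
  rw [hχ, hχ, hχ] at h'
  exact (DirectLimit.sum_eq_some.1 h').exists_stage

/-- The stages cover the limit: the universal property gives a morphism back from the constructed limit, and the
composite endomorphism of `L` is the identity. -/
theorem exists_eq (hφ : IsDirectLimit f φ) (p : L) : ∃ i a, φ i a = p := by
  obtain ⟨χ, hχ⟩ := hφ.exists_comparison
  have hmk : ∀ x : DirectLimit.Carrier f, ∃ p : L,
      ∀ i a, DirectLimit.mk i a = x → φ i a = p := by
    intro x
    obtain ⟨j, b, rfl⟩ := DirectLimit.exists_mk_eq x
    refine ⟨φ j b, fun i a h => ?_⟩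
    obtain ⟨k, hi, hj, h⟩ := DirectLimit.mk_eq.1 h
    rw [← hφ.compatible i k hi, h, hφ.compatible]
  choose ψ hψ using hmk
  let θ : Hom L L :=
    { toFun := fun p => ψ (χ p)
      map_one' := by
        have i := Classical.arbitrary I
        rw [← (φ i).map_one, hχ, ← hψ _ i 1 rfl]
      map_oplus' := fun {p q r} h => by
        obtain ⟨i, a, b, c, ha, hb, hc, h⟩ := DirectLimit.sum_eq_some.1 (χ.map_oplus h)
        rw [← hψ _ i a ha, ← hψ _ i b hb, ← hψ _ i c hc]
        exact (φ i).map_oplus h }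
  have hθ : θ = Hom.id _ := (hφ.universal L φ hφ.compatible).unique
    (fun i a => by
      change ψ (χ (φ i a)) = φ i a
      rw [hχ, ← hψ _ i a rfl]) fun _ _ => rfl
  obtain ⟨i, a, h⟩ := DirectLimit.exists_mk_eq (χ p)
  exact ⟨i, a, (hψ _ i a h).trans (DFunLike.congr_fun hθ p)⟩

end IsDirectLimit

/-! ### The tensor product of directed systems -/

section TensorSystem

variable {I J : Type u} [Preorder I] [Preorder J]
  {A : I → Type u} {B : J → Type u} [∀ i, EffectAlgebra (A i)] [∀ k, EffectAlgebra (B k)]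
  {f : ∀ ⦃j i : I⦄, j ≤ i → Hom (A j) (A i)} {g : ∀ ⦃l k : J⦄, l ≤ k → Hom (B l) (B k)}

theorem tensorSystem_tmul {q p : I × J} (h : q ≤ p) (a : A q.1) (b : B q.2) :
    tensorSystem f g h (tmul a b) = tmul (f h.1 a) (g h.2 b) :=
  tensorMap_tmul _ _ a b

variable [DirectedSystem A (fun _ _ h => f h)] [DirectedSystem B (fun _ _ h => g h)]

theorem directedSystem_tensorSystem :
    DirectedSystem (fun p : I × J => Tensor (A p.1) (B p.2))
      (fun _ _ h => tensorSystem f g h) where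
  map_self p x := by
    have h : tensorSystem f g (le_refl p) = Hom.id _ := Hom.ext_tmul fun a b => by
      rw [tensorSystem_tmul]
      exact congrArg₂ tmul (DirectedSystem.map_self (f := fun _ _ h => f h) a)
        (DirectedSystem.map_self (f := fun _ _ h => g h) b)
    exact DFunLike.congr_fun h x
  map_map r q p hpq hqr x := by
    have h : (tensorSystem f g hqr).comp (tensorSystem f g hpq) =
        tensorSystem f g (hpq.trans hqr) := Hom.ext_tmul fun a b => by
      rw [Hom.comp_apply, tensorSystem_tmul, tensorSystem_tmul, tensorSystem_tmul]
      exact congrArg₂ tmul (DirectedSystem.map_map (f := fun _ _ h => f h) hpq.1 hqr.1 a)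
        (DirectedSystem.map_map (f := fun _ _ h => g h) hpq.2 hqr.2 b)
    exact DFunLike.congr_fun h x

variable [IsDirectedOrder I] [IsDirectedOrder J] [Nonempty I] [Nonempty J]
  {L M : Type u} [EffectAlgebra L] [EffectAlgebra M] {φ : ∀ i, Hom (A i) L} {γ : ∀ k, Hom (B k) M}

/-- A compatible family of bimorphisms `A i × B k → C` induces a bimorphism on the direct limits:
elements and sums in the limits come from stages, which can be taken arbitrarily late. -/
theorem exists_bimorphism_of_compatible (hφ : IsDirectLimit f φ) (hγ : IsDirectLimit g γ)
    {C : Type w} [EffectAlgebra C] (β : ∀ i k, A i → B k → C) (hβ : ∀ i k, IsBimorphism (β i k))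
    (compat : ∀ {i j : I} {k l : J} (hi : i ≤ j) (hk : k ≤ l) (a : A i) (b : B k),
      β j l (f hi a) (g hk b) = β i k a b) :
    ∃ δ : L → M → C, IsBimorphism δ ∧ ∀ i k a b, δ (φ i a) (γ k b) = β i k a b := by
  have key : ∀ p q, ∃ c : C, ∀ i k a b, φ i a = p → γ k b = q → c = β i k a b := by
    intro p q
    obtain ⟨i, a, rfl⟩ := hφ.exists_eq p
    obtain ⟨k, b, rfl⟩ := hγ.exists_eq q
    refine ⟨β i k a b, fun i' k' a' b' ha hb => ?_⟩
    obtain ⟨j, hi', hi, ha⟩ := hφ.exists_map_eq ha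
    obtain ⟨l, hk', hk, hb⟩ := hγ.exists_map_eq hb
    rw [← compat hi hk, ← ha, ← hb, compat]
  choose δ hδ using key
  refine ⟨δ, ⟨fun {p₁ p₂ p₃} q h => ?_, fun p {q₁ q₂ q₃} h => ?_, ?_⟩,
    fun i k a b => hδ _ _ i k a b rfl rfl⟩
  · obtain ⟨i₁, a₁, rfl⟩ := hφ.exists_eq p₁
    obtain ⟨i₂, a₂, rfl⟩ := hφ.exists_eq p₂
    obtain ⟨i₃, a₃, rfl⟩ := hφ.exists_eq p₃
    obtain ⟨k, b, rfl⟩ := hγ.exists_eq q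
    obtain ⟨i, h₁, h₂, h₃, h⟩ := hφ.exists_map_oplus h
    rw [hδ _ _ i k _ b (hφ.compatible _ _ h₁ a₁) rfl, hδ _ _ i k _ b (hφ.compatible _ _ h₂ a₂) rfl,
      hδ _ _ i k _ b (hφ.compatible _ _ h₃ a₃) rfl]
    exact (hβ i k).oplus_left b h
  · obtain ⟨k₁, b₁, rfl⟩ := hγ.exists_eq q₁
    obtain ⟨k₂, b₂, rfl⟩ := hγ.exists_eq q₂
    obtain ⟨k₃, b₃, rfl⟩ := hγ.exists_eq q₃
    obtain ⟨i, a, rfl⟩ := hφ.exists_eq p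
    obtain ⟨k, h₁, h₂, h₃, h⟩ := hγ.exists_map_oplus h
    rw [hδ _ _ i k a _ rfl (hγ.compatible _ _ h₁ b₁), hδ _ _ i k a _ rfl (hγ.compatible _ _ h₂ b₂),
      hδ _ _ i k a _ rfl (hγ.compatible _ _ h₃ b₃)]
    exact (hβ i k).oplus_right a h
  · have i := Classical.arbitrary I
    have k := Classical.arbitrary J
    rw [hδ 1 1 i k 1 1 (φ i).map_one (γ k).map_one, (hβ i k).map_one_one]

/-- The tensor product of effect algebras commutes with direct limits. -/
theorem IsDirectLimit.tensor (hφ : IsDirectLimit f φ) (hγ : IsDirectLimit g γ) :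
    IsDirectLimit (L := Tensor L M) (tensorSystem f g)
      (fun p : I × J => tensorMap (φ p.1) (γ p.2)) where
  compatible q p h x := by
    have h : (tensorMap (φ p.1) (γ p.2)).comp (tensorSystem f g h) =
        tensorMap (φ q.1) (γ q.2) := Hom.ext_tmul fun a b => by
      rw [Hom.comp_apply, tensorSystem_tmul, tensorMap_tmul, tensorMap_tmul, hφ.compatible, hγ.compatible]
    exact DFunLike.congr_fun h x
  universal C _ ψ hψ := by
    obtain ⟨δ, hδ, hδψ⟩ := exists_bimorphism_of_compatible hφ hγ
      (fun i k a b => ψ (i, k) (tmul a b))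
      (fun i k =>
        { oplus_left := fun q h => (ψ (i, k)).map_oplus (isBimorphism_tmul.oplus_left q h)
          oplus_right := fun p _ _ _ h => (ψ (i, k)).map_oplus (isBimorphism_tmul.oplus_right p h)
          map_one_one := (congrArg (ψ (i, k)) isBimorphism_tmul.map_one_one).trans
            (ψ (i, k)).map_one })
      (fun {i j k l} hi hk a b => by
        have h := hψ (i, k) (j, l) ⟨hi, hk⟩ (tmul a b)
        rwa [tensorSystem_tmul] at h)
    obtain ⟨χ, hχ⟩ := exists_lift hδ
    refine ⟨χ, fun p => ?_, fun χ' hχ' => Hom.ext_tmul fun x y => ?_⟩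
    · have h : χ.comp (tensorMap (φ p.1) (γ p.2)) = ψ p := Hom.ext_tmul fun a b => by
        rw [Hom.comp_apply, tensorMap_tmul, hχ, hδψ]
      exact DFunLike.congr_fun h
    · obtain ⟨i, a, rfl⟩ := hφ.exists_eq x
      obtain ⟨k, b, rfl⟩ := hγ.exists_eq y
      rw [hχ, hδψ, ← hχ' (i, k), tensorMap_tmul]

end TensorSystem

theorem IsDimension.tensor {E F : Type u} [EffectAlgebra E] [EffectAlgebra F]
    (hE : IsDimension E) (hF : IsDimension F) : IsDimension (Tensor E F) := by
  obtain ⟨I, _, _, _, A, _, f, φ, _, hA, hφ⟩ := hE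
  obtain ⟨J, _, _, _, B, _, g, γ, _, hB, hγ⟩ := hF
  have directed : IsDirectedOrder (I × J) := ⟨fun p q =>
    let ⟨i, hi, hi'⟩ := exists_ge_ge p.1 q.1
    let ⟨k, hk, hk'⟩ := exists_ge_ge p.2 q.2
    ⟨(i, k), ⟨hi, hk⟩, ⟨hi', hk'⟩⟩⟩
  exact ⟨I × J, inferInstance, directed, inferInstance, fun p => Tensor (A p.1) (B p.2),
    inferInstance, tensorSystem f g, fun p => tensorMap (φ p.1) (γ p.2),
    directedSystem_tensorSystem, fun p => (hA p.1).tensor (hB p.2), hφ.tensor hγ⟩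

end EffectAlgebra

open EffectAlgebra in
theorem mainTheorem2 :
    (∀ (I J : Type u) [Preorder I] [Preorder J] [IsDirectedOrder I] [IsDirectedOrder J]
      [Nonempty I] [Nonempty J]
      (A : I → Type u) (B : J → Type u)
      [∀ i, EffectAlgebra (A i)] [∀ k, EffectAlgebra (B k)]
      (f : ∀ ⦃j i : I⦄, j ≤ i → Hom (A j) (A i)) (g : ∀ ⦃l k : J⦄, l ≤ k → Hom (B l) (B k))
      [DirectedSystem A (fun _ _ h => f h)] [DirectedSystem B (fun _ _ h => g h)]
      (Abar Bbar : Type u) [EffectAlgebra Abar] [EffectAlgebra Bbar]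
      (φ : ∀ i, Hom (A i) Abar) (γ : ∀ k, Hom (B k) Bbar),
      (∀ i, IsSimplicial (A i)) → (∀ k, IsSimplicial (B k)) →
      IsDirectLimit f φ → IsDirectLimit g γ →
        DirectedSystem (fun p : I × J => Tensor (A p.1) (B p.2))
          (fun _ _ h => tensorSystem f g h) ∧
        (∀ p : I × J, IsSimplicial (Tensor (A p.1) (B p.2))) ∧
        IsDirectLimit (L := Tensor Abar Bbar) (tensorSystem f g)
          (fun p : I × J => tensorMap (φ p.1) (γ p.2))) ∧
    (∀ (E F : Type u) [EffectAlgebra E] [EffectAlgebra F],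
      IsDimension E → IsDimension F → IsDimension (Tensor E F)) := by
  refine ⟨?_, fun E F _ _ hE hF => hE.tensor hF⟩
  intro I J _ _ _ _ _ _ A B _ _ f g _ _ Abar Bbar _ _ φ γ hA hB hφ hγ
  exact ⟨directedSystem_tensorSystem, fun p => (hA p.1).tensor (hB p.2), hφ.tensor hγ⟩
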